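/- Let $\alpha,\beta\ge\frac12$ be real numbers and, for each integer $n\ge0$, let $L_n(t)=\sum_{k=0}^n\binom nk\frac{(-1)^k}{k!}t^k$ be the Laguerre polynomial of degree $n$. For $t\ge0$ and $n\ge0$ put $$\phi_n(t)=\sqrt{\alpha+\beta}\,e^{-\alpha t}L_n\big((\alpha+\beta)t\big),\qquad \psi_n(t)=\sqrt{\alpha+\beta}\,e^{-\beta t}L_n\big((\alpha+\beta)t\big).$$ Then all $\phi_n$ and $\psi_n$ belong to the Hilbert space $L^2[0,\infty)$ (with Lebesgue measure, and real or complex scalars). The sequences $\{\phi_n\}_{n\ge0}$ and $\{\psi_n\}_{n\ge0}$ are biorthogonal, i.e. $\langle\phi_m,\psi_n\rangle=\delta_{m,n}$ for all $m,n\ge0$, and each of them spans $L^2[0,\infty)$: the closure of the linear span of $\{\phi_n\}_{n\ge0}$ is $L^2[0,\infty)$, and so is the closure of the linear span of $\{\psi_n\}_{n\ge0}$. -/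

import Mathlib

namespace LaguerreBiorthogonal

open MeasureTheory

/-- The classical Laguerre polynomial `L_n(t) = ∑_{k=0}^n (-1)^k (n choose k) t^k / k!`. -/
noncomputable def laguerre (n : ℕ) : Polynomial ℝ :=
  ∑ k ∈ Finset.range (n + 1),
    Polynomial.monomial k ((-1 : ℝ) ^ k * (n.choose k : ℝ) / (k.factorial : ℝ))

/-- `φ_n(t) = √(α+β) e^{-αt} L_n((α+β)t)`, regarded as a `𝕜`-valued function. -/
noncomputable def phi (𝕜 : Type*) [RCLike 𝕜] (α β : ℝ) (n : ℕ) (t : ℝ) : 𝕜 :=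
  ((√(α + β) * Real.exp (-α * t) * (laguerre n).eval ((α + β) * t) : ℝ) : 𝕜)

/-- `ψ_n(t) = √(α+β) e^{-βt} L_n((α+β)t)`, regarded as a `𝕜`-valued function. -/
noncomputable def psi (𝕜 : Type*) [RCLike 𝕜] (α β : ℝ) (n : ℕ) (t : ℝ) : 𝕜 :=
  ((√(α + β) * Real.exp (-β * t) * (laguerre n).eval ((α + β) * t) : ℝ) : 𝕜)

/-- Lebesgue measure on `[0, ∞)`. -/
noncomputable abbrev halfLine : Measure ℝ := volume.restrict (Set.Ici 0)

/-- Two sequences in an inner product space are biorthogonal if `⟨f_m, g_n⟩ = δ_{m,n}`. -/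
def Biorthogonal (𝕜 : Type*) {H : Type*} [RCLike 𝕜] [NormedAddCommGroup H]
    [InnerProductSpace 𝕜 H] (f g : ℕ → H) : Prop :=
  ∀ m n : ℕ, inner 𝕜 (f m) (g n) = if m = n then 1 else 0

/-- A sequence spans (is total in) the space if the closure of its linear span is everything. -/
def Spans (𝕜 : Type*) {H : Type*} [RCLike 𝕜] [NormedAddCommGroup H]
    [InnerProductSpace 𝕜 H] (f : ℕ → H) : Prop :=
  (Submodule.span 𝕜 (Set.range f)).topologicalClosure = ⊤

end LaguerreBiorthogonal

namespace LaguerreBiorthogonal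

open MeasureTheory Polynomial

/-! With s = α + β, the product of φ_m and ψ_n is s e^{-st} L_m(st) L_n(st), so biorthogonality is
classical Laguerre orthogonality after rescaling; that in turn comes from reading Laguerre moments
as finite differences (`expIntegral_X_pow_mul_laguerre`).

For totality, let f be orthogonal to one family, hence to every e^{-at} p(t), where a is α or β.
Expanding e^{-ct} in powers of t, with 0 < c < a, shows that f is also orthogonal to every
e^{-(a+c)t} p(t) (`integral_expPoly_add_smul_eq_zero`). Iterating, the integrable function e^{-at} f
is orthogonal to all powers of e^{-ct}, and Weierstrass approximation in the variable x = e^{-ct}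
forces f = 0. -/

/-- The exponentially damped polynomial `e^{-at} p(t)`. -/
noncomputable def expPoly (a : ℝ) (p : ℝ[X]) (t : ℝ) : ℝ :=
  Real.exp (-a * t) * p.eval t

lemma continuous_expPoly (a : ℝ) (p : ℝ[X]) : Continuous (expPoly a p) := by
  unfold expPoly
  fun_prop

lemma expPoly_add (a : ℝ) (p q : ℝ[X]) (t : ℝ) :
    expPoly a (p + q) t = expPoly a p t + expPoly a q t := by
  simp [expPoly, mul_add]

lemma expPoly_C_mul (a c : ℝ) (p : ℝ[X]) (t : ℝ) :
    expPoly a (C c * p) t = c * expPoly a p t := by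
  simp [expPoly, mul_left_comm]

lemma expPoly_mul_expPoly (a b : ℝ) (p q : ℝ[X]) (t : ℝ) :
    expPoly a p t * expPoly b q t = expPoly (a + b) (p * q) t := by
  simp only [expPoly, eval_mul, neg_add, add_mul, Real.exp_add]
  ring

lemma integrable_expPoly_X_pow {a : ℝ} (ha : 0 < a) (k : ℕ) :
    Integrable (expPoly a (X ^ k)) halfLine := by
  have h := integrableOn_rpow_mul_exp_neg_mul_rpow (p := 1) (s := k) (b := a)
    (by have : (0 : ℝ) ≤ k := k.cast_nonneg
        linarith) one_pos ha
  rw [← integrableOn_Ici_iff_integrableOn_Ioi] at h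
  refine h.congr (Filter.Eventually.of_forall fun t => ?_)
  simp [expPoly, mul_comm]

lemma integrable_expPoly {a : ℝ} (ha : 0 < a) (p : ℝ[X]) :
    Integrable (expPoly a p) halfLine := by
  induction p using Polynomial.induction_on' with
  | add p q hp hq =>
    exact (hp.add hq).congr (Filter.Eventually.of_forall fun t => (expPoly_add a p q t).symm)
  | monomial n c =>
    refine ((integrable_expPoly_X_pow ha n).const_mul c).congr
      (Filter.Eventually.of_forall fun t => ?_)
    simp only [← expPoly_C_mul, C_mul_X_pow_eq_monomial]

lemma memLp_expPoly {a : ℝ} (ha : 0 < a) (p : ℝ[X]) : MemLp (expPoly a p) 2 halfLine := by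
  rw [memLp_two_iff_integrable_sq (continuous_expPoly a p).aestronglyMeasurable]
  simp only [sq, expPoly_mul_expPoly]
  exact integrable_expPoly (by linarith) _

/-! ### Orthogonality of the Laguerre polynomials -/

/-- The linear functional `p ↦ ∫₀^∞ e^{-t} p(t) dt`. -/
noncomputable def expIntegral : ℝ[X] →ₗ[ℝ] ℝ where
  toFun p := ∫ t, expPoly 1 p t ∂halfLine
  map_add' p q := by
    simp only [expPoly_add]
    exact integral_add (integrable_expPoly one_pos p) (integrable_expPoly one_pos q)
  map_smul' c p := by
    simp only [smul_eq_C_mul, expPoly_C_mul, integral_const_mul, RingHom.id_apply, smul_eq_mul]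

lemma expIntegral_X_pow (k : ℕ) : expIntegral (X ^ k) = k.factorial := by
  rw [← Real.Gamma_nat_eq_factorial, Real.Gamma_eq_integral (by positivity)]
  simp [expIntegral, expPoly, halfLine, integral_Ici_eq_integral_Ioi]

lemma expIntegral_C_mul (c : ℝ) (p : ℝ[X]) : expIntegral (C c * p) = c * expIntegral p := by
  rw [← smul_eq_C_mul, map_smul, smul_eq_mul]

/-- Since (j+k)!/k! = (k+1)⋯(k+j) is a polynomial of degree j in k, the alternating binomial sum is
an n-th difference: it is zero for j < n and explicit for j = n. -/
lemma expIntegral_X_pow_mul_laguerre (j n : ℕ) :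
    expIntegral (X ^ j * laguerre n) =
      (-1) ^ n * (fwdDiff 1)^[n] (ascPochhammer ℝ j).eval 1 := by
  rw [fwdDiff_iter_eq_sum_shift, laguerre, Finset.mul_sum, map_sum, Finset.mul_sum]
  refine Finset.sum_congr rfl fun k hk => ?_
  have hk' : k ≤ n := Nat.lt_succ_iff.mp (Finset.mem_range.mp hk)
  have h := factorial_mul_ascPochhammer ℝ k j
  have hf : (k.factorial : ℝ) ≠ 0 := by positivity
  have hsign : (-1 : ℝ) ^ n * (-1) ^ (n - k) = (-1) ^ k := by
    obtain ⟨d, rfl⟩ := Nat.exists_eq_add_of_le hk'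
    rw [Nat.add_sub_cancel_left, pow_add, mul_assoc, ← mul_pow]
    simp
  rw [← C_mul_X_pow_eq_monomial, mul_left_comm, ← pow_add, expIntegral_C_mul, expIntegral_X_pow,
    add_comm j k, ← h, ← hsign, nsmul_one, add_comm (1 : ℝ), zsmul_eq_mul]
  push_cast
  field_simp

lemma expIntegral_mul_laguerre {n : ℕ} {p : ℝ[X]} (hp : p.natDegree ≤ n) :
    expIntegral (p * laguerre n) = p.coeff n * ((-1) ^ n * n.factorial) := by
  conv_lhs => rw [p.as_sum_range_C_mul_X_pow' (Nat.lt_succ_iff.mpr hp)]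
  rw [Finset.sum_mul, map_sum, Finset.sum_range_succ, Finset.sum_eq_zero, zero_add]
  · have h := (ascPochhammer ℝ n).fwdDiff_iter_degree_eq_factorial
    rw [ascPochhammer_natDegree, (monic_ascPochhammer ℝ n).leadingCoeff, one_smul] at h
    rw [mul_assoc, expIntegral_C_mul, expIntegral_X_pow_mul_laguerre, h]
    simp
  · intro j hj
    rw [mul_assoc, expIntegral_C_mul, expIntegral_X_pow_mul_laguerre,
      fwdDiff_iter_eq_zero_of_degree_lt]
    · simp
    · rw [ascPochhammer_natDegree]
      exact Finset.mem_range.mp hj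

lemma coeff_laguerre_self (n : ℕ) : (laguerre n).coeff n = (-1) ^ n / n.factorial := by
  simp [laguerre, coeff_monomial]

lemma natDegree_laguerre_le (n : ℕ) : (laguerre n).natDegree ≤ n :=
  natDegree_sum_le_of_forall_le _ _ fun _ hk =>
    (natDegree_monomial_le _).trans (Nat.lt_succ_iff.mp (Finset.mem_range.mp hk))

lemma degree_laguerre (n : ℕ) : (laguerre n).degree = n := by
  refine le_antisymm (natDegree_le_iff_degree_le.mp (natDegree_laguerre_le n)) ?_
  apply le_degree_of_ne_zero
  rw [coeff_laguerre_self]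
  positivity

lemma expIntegral_laguerre_mul_laguerre (m n : ℕ) :
    expIntegral (laguerre m * laguerre n) = if m = n then 1 else 0 := by
  rcases lt_trichotomy m n with h | rfl | h
  · rw [expIntegral_mul_laguerre ((natDegree_laguerre_le m).trans h.le), if_neg h.ne,
      coeff_eq_zero_of_natDegree_lt ((natDegree_laguerre_le m).trans_lt h), zero_mul]
  · rw [expIntegral_mul_laguerre (natDegree_laguerre_le m), coeff_laguerre_self, if_pos rfl]
    have hf : (m.factorial : ℝ) ≠ 0 := by positivity
    field_simp
    rw [← pow_mul, mul_comm, pow_mul]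
    simp
  · rw [mul_comm, expIntegral_mul_laguerre ((natDegree_laguerre_le n).trans h.le), if_neg h.ne',
      coeff_eq_zero_of_natDegree_lt ((natDegree_laguerre_le n).trans_lt h), zero_mul]

/-- The Laguerre polynomials as a sequence with one polynomial of each degree. -/
noncomputable def laguerreSequence : Polynomial.Sequence ℝ where
  elems' := laguerre
  degree_eq' := degree_laguerre

lemma span_laguerre : Submodule.span ℝ (Set.range laguerre) = ⊤ :=
  laguerreSequence.span fun i =>
    (leadingCoeff_ne_zero.mpr (laguerreSequence.ne_zero i)).isUnit

/-! ### Totality of damped polynomials -/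

variable {𝕜 : Type*} [RCLike 𝕜]

lemma integrable_expPoly_smul {a : ℝ} (ha : 0 < a) (p : ℝ[X]) {f : ℝ → 𝕜}
    (hf : MemLp f 2 halfLine) : Integrable (fun t => expPoly a p t • f t) halfLine :=
  memLp_one_iff_integrable.mp (hf.smul (r := 1) (memLp_expPoly ha p))

lemma integral_expPoly_smul_eq_zero {a : ℝ} (ha : 0 < a) {f : ℝ → 𝕜}
    (hf : MemLp f 2 halfLine) {P : Set ℝ[X]} (hP : Submodule.span ℝ P = ⊤)
    (h : ∀ p ∈ P, ∫ t, expPoly a p t • f t ∂halfLine = 0) (p : ℝ[X]) :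
    ∫ t, expPoly a p t • f t ∂halfLine = 0 := by
  have hp : p ∈ Submodule.span ℝ P := hP ▸ Submodule.mem_top
  induction hp using Submodule.span_induction with
  | mem p hp => exact h p hp
  | zero => simp [expPoly]
  | add p q _ _ ihp ihq =>
    simp only [expPoly_add, add_smul]
    rw [integral_add (integrable_expPoly_smul ha p hf) (integrable_expPoly_smul ha q hf), ihp, ihq,
      add_zero]
  | smul c p _ ih =>
    simp only [smul_eq_C_mul, expPoly_C_mul, mul_smul]
    rw [integral_smul, ih, smul_zero]

/-- Vanishing of all moments against `e^{-at}` passes to the faster decaying weight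
`e^{-(a+c)t}`, by expanding `e^{-ct}` in its power series. -/
lemma integral_expPoly_add_smul_eq_zero {a c : ℝ} (hc : 0 ≤ c) (hca : c < a) {f : ℝ → 𝕜}
    (hf : MemLp f 2 halfLine) (h : ∀ p, ∫ t, expPoly a p t • f t ∂halfLine = 0) (p : ℝ[X]) :
    ∫ t, expPoly (a + c) p t • f t ∂halfLine = 0 := by
  have hexp : ∀ x : ℝ, HasSum (fun j : ℕ => x ^ j / j.factorial) (Real.exp x) := fun x => by
    rw [Real.exp_eq_exp_ℝ]
    exact NormedSpace.expSeries_div_hasSum_exp x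
  -- The dominating series sums to the norm with weight e^{-(a-c)t}, which is integrable because c <
  -- a.
  have hbound : ∀ t, HasSum (fun j : ℕ => (c * t) ^ j / j.factorial * ‖expPoly a p t • f t‖)
      ‖expPoly (a - c) p t • f t‖ := fun t => by
    convert! (hexp (c * t)).mul_right ‖expPoly a p t • f t‖ using 1
    rw [norm_smul, norm_smul, ← mul_assoc]
    congr 1
    simp only [expPoly, norm_mul, Real.norm_eq_abs, Real.abs_exp]
    rw [← mul_assoc, ← Real.exp_add]
    ring_nf
  have key := hasSum_integral_of_dominated_convergence (μ := halfLine)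
    (F := fun (j : ℕ) t => ((-c * t) ^ j / j.factorial) • expPoly a p t • f t)
    (f := fun t => expPoly (a + c) p t • f t)
    (fun j t => (c * t) ^ j / j.factorial * ‖expPoly a p t • f t‖)
    (fun j => (Continuous.aestronglyMeasurable (by fun_prop)).smul
      ((continuous_expPoly a p).aestronglyMeasurable.smul hf.1))
    (fun j => by
      filter_upwards [ae_restrict_mem measurableSet_Ici] with t ht
      have : 0 ≤ c * t := mul_nonneg hc ht
      rw [norm_smul, norm_div, norm_pow, neg_mul, norm_neg, Real.norm_of_nonneg this,
        RCLike.norm_natCast])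
    (Filter.Eventually.of_forall fun t => (hbound t).summable)
    (by
      simp only [(hbound _).tsum_eq]
      exact (integrable_expPoly_smul (sub_pos.mpr hca) p hf).norm)
    (Filter.Eventually.of_forall fun t => by
      convert! (hexp (-c * t)).smul_const (expPoly a p t • f t) using 1
      rw [← mul_smul]
      simp only [expPoly, neg_add, add_mul, Real.exp_add]
      ring_nf)
  have hzero : ∀ j : ℕ,
      ∫ t, ((-c * t) ^ j / j.factorial) • expPoly a p t • f t ∂halfLine = 0 := fun j => by
    rw [← h (C ((-c) ^ j / j.factorial) * (X ^ j * p))]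
    congr 1 with t
    rw [← mul_smul]
    simp only [expPoly, eval_mul, eval_C, eval_pow, eval_X]
    ring_nf
  simp only [hzero] at key
  exact key.unique hasSum_zero

lemma integral_expPoly_add_nat_mul_smul_eq_zero {a c : ℝ} (hc : 0 ≤ c) (hca : c < a) {f : ℝ → 𝕜}
    (hf : MemLp f 2 halfLine) (h : ∀ p, ∫ t, expPoly a p t • f t ∂halfLine = 0) (k : ℕ)
    (p : ℝ[X]) : ∫ t, expPoly (a + k * c) p t • f t ∂halfLine = 0 := by
  induction k generalizing p with
  | zero => simpa using h p
  | succ k ih =>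
    have hk : a + (k + 1 : ℕ) * c = (a + k * c) + c := by push_cast; ring
    rw [hk]
    exact integral_expPoly_add_smul_eq_zero hc
      (hca.trans_le (le_add_of_nonneg_right (by positivity))) hf ih p

/-- A compactly supported test function on `(0, ∞)` is a continuous function of `e^{-ct}`. -/
lemma continuous_comp_neg_log_div {c : ℝ} (hc : 0 < c) {g : ℝ → ℝ} (hg : Continuous g)
    (hcs : HasCompactSupport g) (hsupp : tsupport g ⊆ Set.Ioi 0) :
    Continuous fun x => g (-Real.log x / c) := by
  rw [continuous_iff_continuousAt]
  intro x
  rcases eq_or_ne x 0 with rfl | hx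
  -- With the convention log 0 = 0 the value at x = 0 is g 0, which vanishes and so agrees with the
  -- limit of g at infinity.
  · have h0 : g 0 = 0 := image_eq_zero_of_notMem_tsupport fun h => lt_irrefl (0 : ℝ) (hsupp h)
    rw [continuousAt_iff_punctured_nhds]
    simp only [Real.log_zero, neg_zero, zero_div, h0]
    have hlim : Filter.Tendsto (fun x => -Real.log x / c) (nhdsWithin 0 {0}ᶜ) Filter.atTop :=
      (Filter.tendsto_neg_atBot_atTop.comp Real.tendsto_log_nhdsNE_zero).atTop_div_const hc
    exact (hcs.is_zero_at_infty.mono_left atTop_le_cocompact).comp hlim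
  · exact hg.continuousAt.comp ((Real.continuousAt_log hx).neg.div_const c)

/-- If `g` is integrable on the half-line and orthogonal to all powers of `e^{-ct}`, then
`g = 0` almost everywhere. -/
lemma ae_eq_zero_of_integral_exp_smul_eq_zero {c : ℝ} (hc : 0 < c) {g : ℝ → 𝕜}
    (hg : Integrable g halfLine)
    (h : ∀ k : ℕ, ∫ t, (Real.exp (-c * t)) ^ k • g t ∂halfLine = 0) : g =ᵐ[halfLine] 0 := by
  have hpow : ∀ k : ℕ, Integrable (fun t => (Real.exp (-c * t)) ^ k • g t) halfLine := fun k => by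
    have hcont : Continuous fun t => Real.exp (-c * t) ^ k := by fun_prop
    refine hg.bdd_smul 1 hcont.aestronglyMeasurable ?_
    filter_upwards [ae_restrict_mem measurableSet_Ici] with t ht
    rw [norm_pow, Real.norm_eq_abs, Real.abs_exp]
    refine pow_le_one₀ (Real.exp_pos _).le (Real.exp_le_one_iff.mpr ?_)
    rw [neg_mul]
    exact neg_nonpos.mpr (mul_nonneg hc.le ht)
  have hpoly : ∀ p : ℝ[X], Integrable (fun t => p.eval (Real.exp (-c * t)) • g t) halfLine ∧
      ∫ t, p.eval (Real.exp (-c * t)) • g t ∂halfLine = 0 := fun p => by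
    induction p using Polynomial.induction_on' with
    | add p q hp hq =>
      simp only [eval_add, add_smul]
      exact ⟨hp.1.add hq.1, by rw [integral_add hp.1 hq.1, hp.2, hq.2, add_zero]⟩
    | monomial n b =>
      simp only [eval_monomial, mul_smul]
      exact ⟨(hpow n).smul b, by rw [integral_smul, h n, smul_zero]⟩
  have htest : ∀ φ : ℝ → ℝ, ContDiff ℝ (⊤ : ℕ∞) φ → HasCompactSupport φ →
      tsupport φ ⊆ Set.Ioi 0 → ∫ t, φ t • g t = 0 := fun φ hφ hcs hsupp => by
    have hres : ∫ t, φ t • g t = ∫ t, φ t • g t ∂halfLine := by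
      refine (setIntegral_eq_integral_of_forall_compl_eq_zero fun t ht => ?_).symm
      rw [image_eq_zero_of_notMem_tsupport fun h => ht (Set.Ioi_subset_Ici_self (hsupp h)),
        zero_smul]
    have hcont := continuous_comp_neg_log_div hc hφ.continuous hcs hsupp
    have hφlog : ∀ t, φ t = φ (-Real.log (Real.exp (-c * t)) / c) := fun t => by
      rw [Real.log_exp]
      congr 1
      field_simp
    have hφint : Integrable (fun t => φ t • g t) halfLine := by
      obtain ⟨B, hB⟩ := hφ.continuous.bounded_above_of_compact_support hcs
      exact hg.bdd_smul B hφ.continuous.aestronglyMeasurable (Filter.Eventually.of_forall hB)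
    have hsmall : ∀ ε > 0, ‖∫ t, φ t • g t ∂halfLine‖ ≤ ε * ∫ t, ‖g t‖ ∂halfLine := by
      intro ε hε
      -- Weierstrass on [0, 1], the range containing e^{-ct}; subtracting p(e^{-ct}) does not change
      -- the integral.
      obtain ⟨p, hp⟩ := exists_polynomial_near_of_continuousOn 0 1 _ hcont.continuousOn ε hε
      rw [← sub_zero (∫ t, φ t • g t ∂halfLine), ← (hpoly p).2,
        ← integral_sub hφint (hpoly p).1, ← integral_const_mul]
      refine norm_integral_le_of_norm_le (hg.norm.const_mul ε) ?_
      filter_upwards [ae_restrict_mem measurableSet_Ici] with t ht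
      have ht' : -c * t ≤ 0 := by
        rw [neg_mul]
        exact neg_nonpos.mpr (mul_nonneg hc.le ht)
      have hpt := hp _ ⟨(Real.exp_pos _).le, Real.exp_le_one_iff.mpr ht'⟩
      rw [← hφlog, abs_sub_comm] at hpt
      rw [← sub_smul, norm_smul]
      exact mul_le_mul_of_nonneg_right hpt.le (norm_nonneg _)
    rw [hres, ← norm_le_zero_iff]
    have hlim : Filter.Tendsto (fun ε : ℝ => ε * ∫ t, ‖g t‖ ∂halfLine) (nhds 0) (nhds 0) := by
      simpa using (Filter.tendsto_id (α := ℝ) (x := nhds 0)).mul_const (∫ t, ‖g t‖ ∂halfLine)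
    exact ge_of_tendsto (hlim.mono_left (nhdsWithin_le_nhds (s := Set.Ioi 0)))
      (Filter.eventually_of_mem self_mem_nhdsWithin hsmall)
  have hloc : LocallyIntegrableOn g (Set.Ioi 0) volume :=
    (IntegrableOn.mono_set hg Set.Ioi_subset_Ici_self).locallyIntegrableOn
  have hae := isOpen_Ioi.ae_eq_zero_of_integral_contDiff_smul_eq_zero hloc htest
  rw [halfLine, ← restrict_Ioi_eq_restrict_Ici]
  exact (ae_restrict_iff' measurableSet_Ioi).mpr hae

/-- A function in `L²[0, ∞)` orthogonal to every `e^{-at} p(t)`, `p` a polynomial, vanishes. -/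
lemma ae_eq_zero_of_integral_expPoly_smul_eq_zero {a : ℝ} (ha : 0 < a) {f : ℝ → 𝕜}
    (hf : MemLp f 2 halfLine) (h : ∀ p, ∫ t, expPoly a p t • f t ∂halfLine = 0) :
    f =ᵐ[halfLine] 0 := by
  -- Any c strictly between 0 and a would serve; here c = a/2.
  have hz := ae_eq_zero_of_integral_exp_smul_eq_zero (half_pos ha)
    (integrable_expPoly_smul ha 1 hf) fun k => by
      rw [← integral_expPoly_add_nat_mul_smul_eq_zero (half_pos ha).le (half_lt_self ha) hf h k 1]
      congr 1 with t
      rw [← mul_smul, ← Real.exp_nat_mul]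
      simp only [expPoly, eval_one, mul_one, ← Real.exp_add]
      ring_nf
  filter_upwards [hz] with t ht
  simpa [expPoly] using ht

/-! ### Transfer to φ and ψ -/

/-- The polynomial factor `√s L_n(st)` common to `phi` and `psi`, where `s = α + β`. -/
noncomputable def scaledLaguerre (s : ℝ) (n : ℕ) : ℝ[X] :=
  C √s * (laguerre n).comp (C s * X)

lemma expPoly_scaledLaguerre (a s : ℝ) (n : ℕ) (t : ℝ) :
    expPoly a (scaledLaguerre s n) t = √s * Real.exp (-a * t) * (laguerre n).eval (s * t) := by
  simp [expPoly, scaledLaguerre, mul_left_comm, mul_assoc]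

lemma phi_eq (α β : ℝ) (n : ℕ) :
    phi 𝕜 α β n = fun t => ((expPoly α (scaledLaguerre (α + β) n) t : ℝ) : 𝕜) := by
  ext t
  rw [phi, expPoly_scaledLaguerre]

lemma psi_eq (α β : ℝ) (n : ℕ) :
    psi 𝕜 α β n = fun t => ((expPoly β (scaledLaguerre (α + β) n) t : ℝ) : 𝕜) := by
  ext t
  rw [psi, expPoly_scaledLaguerre]

lemma integral_expPoly_scaledLaguerre_mul {s : ℝ} (hs : 0 < s) (m n : ℕ) :
    ∫ t, expPoly s (scaledLaguerre s m * scaledLaguerre s n) t ∂halfLine =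
      if m = n then 1 else 0 := by
  have h : ∀ t, expPoly s (scaledLaguerre s m * scaledLaguerre s n) t =
      s * expPoly 1 (laguerre m * laguerre n) (s * t) := fun t => by
    simp only [expPoly, scaledLaguerre, eval_mul, eval_C, eval_comp, eval_X]
    conv_rhs => enter [1]; rw [← Real.mul_self_sqrt hs.le]
    ring_nf
  simp only [h, integral_const_mul]
  rw [← expIntegral_laguerre_mul_laguerre, halfLine, integral_Ici_eq_integral_Ioi,
    integral_comp_mul_left_Ioi (expPoly 1 (laguerre m * laguerre n)) 0 hs, mul_zero, smul_eq_mul,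
    mul_inv_cancel_left₀ hs.ne', ← integral_Ici_eq_integral_Ioi]
  rfl

/-- For s > 0 the linear map p ↦ √s p(sX) is surjective, so it carries a spanning set to a spanning
set. -/
lemma span_scaledLaguerre {s : ℝ} (hs : 0 < s) :
    Submodule.span ℝ (Set.range (scaledLaguerre s)) = ⊤ := by
  let T : ℝ[X] →ₗ[ℝ] ℝ[X] := √s • (aeval (C s * X : ℝ[X])).toLinearMap
  have hT : ∀ p, T p = C √s * p.comp (C s * X) := fun p => by
    simp [T, smul_eq_C_mul, aeval_def, comp]
  have hrange : Set.range (scaledLaguerre s) = T '' Set.range laguerre := by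
    rw [← Set.range_comp]
    congr 1 with n
    simp [hT, scaledLaguerre]
  rw [hrange, ← Submodule.map_span, span_laguerre, Submodule.map_top, LinearMap.range_eq_top]
  intro p
  refine ⟨C (√s)⁻¹ * p.comp (C s⁻¹ * X), ?_⟩
  have hs' : √s ≠ 0 := (Real.sqrt_pos.mpr hs).ne'
  rw [hT, mul_comp, C_comp, ← mul_assoc, ← C_mul, mul_inv_cancel₀ hs', C_1, one_mul, comp_assoc]
  rw [mul_comp, C_comp, X_comp, ← mul_assoc, ← C_mul, inv_mul_cancel₀ hs.ne', C_1, one_mul, comp_X]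

lemma memLp_ofReal_expPoly {a : ℝ} (ha : 0 < a) (p : ℝ[X]) :
    MemLp (fun t => ((expPoly a p t : ℝ) : 𝕜)) 2 halfLine :=
  (memLp_expPoly ha p).ofReal

/-- Totality is equivalent to a trivial orthogonal complement; stated for general a so as to cover
both families. -/
lemma spans_of_span_eq_top {a : ℝ} (ha : 0 < a) {p : ℕ → ℝ[X]}
    (hp : Submodule.span ℝ (Set.range p) = ⊤) {u : ℕ → ℝ → 𝕜}
    (hu : ∀ n, u n = fun t => ((expPoly a (p n) t : ℝ) : 𝕜))
    (hmem : ∀ n, MemLp (u n) 2 halfLine) : Spans 𝕜 fun n => (hmem n).toLp := by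
  rw [Spans, Submodule.topologicalClosure_eq_top_iff, Submodule.eq_bot_iff]
  intro F hF
  rw [Submodule.mem_orthogonal] at hF
  rw [Lp.eq_zero_iff_ae_eq_zero]
  refine ae_eq_zero_of_integral_expPoly_smul_eq_zero ha (Lp.memLp F)
    (integral_expPoly_smul_eq_zero ha (Lp.memLp F) hp ?_)
  rintro _ ⟨n, rfl⟩
  rw [← hF _ (Submodule.subset_span ⟨n, rfl⟩), L2.inner_def]
  refine integral_congr_ae ?_
  filter_upwards [(hmem n).coeFn_toLp] with t ht
  rw [ht, hu, RCLike.inner_apply, RCLike.conj_ofReal, RCLike.real_smul_eq_coe_mul, mul_comm]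

lemma biorthogonal_phi_psi {α β : ℝ} (hs : 0 < α + β)
    (hφ : ∀ n, MemLp (phi 𝕜 α β n) 2 halfLine) (hψ : ∀ n, MemLp (psi 𝕜 α β n) 2 halfLine) :
    Biorthogonal 𝕜 (fun n => (hφ n).toLp) (fun n => (hψ n).toLp) := by
  intro m n
  rw [L2.inner_def]
  have hint : ∫ t, inner 𝕜 ((hφ m).toLp (phi 𝕜 α β m) t) ((hψ n).toLp (psi 𝕜 α β n) t) ∂halfLine =
      ∫ t, ((expPoly (α + β) (scaledLaguerre (α + β) m * scaledLaguerre (α + β) n) t : ℝ) : 𝕜)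
        ∂halfLine := by
    refine integral_congr_ae ?_
    filter_upwards [(hφ m).coeFn_toLp, (hψ n).coeFn_toLp] with t h₁ h₂
    rw [h₁, h₂, phi_eq, psi_eq, RCLike.inner_apply, RCLike.conj_ofReal, ← RCLike.ofReal_mul,
      mul_comm, expPoly_mul_expPoly]
  rw [hint, integral_ofReal, integral_expPoly_scaledLaguerre_mul hs]
  split_ifs <;> simp

end LaguerreBiorthogonal

theorem lemma4p1 (𝕜 : Type*) [RCLike 𝕜] (α β : ℝ) (hα : 1 / 2 ≤ α) (hβ : 1 / 2 ≤ β) :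
    ∃ (hφ : ∀ n : ℕ, MeasureTheory.MemLp (LaguerreBiorthogonal.phi 𝕜 α β n) 2
          LaguerreBiorthogonal.halfLine)
      (hψ : ∀ n : ℕ, MeasureTheory.MemLp (LaguerreBiorthogonal.psi 𝕜 α β n) 2
          LaguerreBiorthogonal.halfLine),
      LaguerreBiorthogonal.Biorthogonal 𝕜 (fun n => (hφ n).toLp) (fun n => (hψ n).toLp) ∧
      LaguerreBiorthogonal.Spans 𝕜 (fun n => (hφ n).toLp) ∧
      LaguerreBiorthogonal.Spans 𝕜 (fun n => (hψ n).toLp) := by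
  have hα₀ : 0 < α := one_half_pos.trans_le hα
  have hβ₀ : 0 < β := one_half_pos.trans_le hβ
  have hs : 0 < α + β := add_pos hα₀ hβ₀
  refine ⟨fun n => ?_, fun n => ?_, LaguerreBiorthogonal.biorthogonal_phi_psi hs _ _,
    LaguerreBiorthogonal.spans_of_span_eq_top hα₀ (LaguerreBiorthogonal.span_scaledLaguerre hs)
      (LaguerreBiorthogonal.phi_eq α β) _,
    LaguerreBiorthogonal.spans_of_span_eq_top hβ₀ (LaguerreBiorthogonal.span_scaledLaguerre hs)
      (LaguerreBiorthogonal.psi_eq α β) _⟩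
  · rw [LaguerreBiorthogonal.phi_eq]
    exact LaguerreBiorthogonal.memLp_ofReal_expPoly hα₀ _
  · rw [LaguerreBiorthogonal.psi_eq]
    exact LaguerreBiorthogonal.memLp_ofReal_expPoly hβ₀ _
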